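/- Let $d\ge 1$, let $\rho_1,\dots,\rho_d\ge 0$ be not all zero, let $\delta_1,\dots,\delta_d\in\mathbb R$, and let $\lambda:\mathbb R\to[0,\infty)$ be locally integrable. Let $X_1,\dots,X_d$ be independent inhomogeneous Poisson point processes on $\mathbb R$, where $X_i$ has intensity function $\lambda_i(t)=\rho_i e^{\delta_i}\lambda(t)$; that is, $X_i$ is a random locally finite set of points whose counts on disjoint Borel sets are independent, the count on $B$ being Poisson with mean $\int_B\lambda_i(s)\,ds$. Mark each point of $X_i$ with the index $i$, and put $$\theta_i=\frac{\rho_i e^{\delta_i}}{\sum_{j=1}^d\rho_j e^{\delta_j}},\qquad \theta=(\theta_1,\dots,\theta_d),$$ which does not depend on $\lambda$. Fix any time $t\in\mathbb R$. (a) For every $n\ge 0$ and every $i$, conditionally on the history up to time $t$ and on the times and marks of the first $n$ points (of any of the processes) after $t$, and given that there is a further point, the next point has mark $i$ with probability $\theta_i$. In other words, for every event $A$ of this history, $$\mathbb P(A\cap\{\text{the }(n+1)\text{-th point after }t\text{ exists and has mark } i\})=\theta_i\,\mathbb P(A\cap\{\text{the }(n+1)\text{-th point after }t\text{ exists}\}).$$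 The case $n=0$ concerns the next point after the fixed time $t$, the case $n\ge 1$ the next point as seen immediately after the $n$-th point following $t$. (b) If $\int_t^\infty\lambda(s)\,ds=\infty$, then almost surely there are infinitely many points after $t$, the probability that the next point after $t$ has mark $i$ is $\theta_i$ for every $i$, and the sequence of marks of the successive points after $t$, coded as unit vectors in $\{0,1\}^d$, is a sequence of independent $\mathrm{Multinomial}(1,\theta)$ random variables. -/

import Mathlib

open MeasureTheory ProbabilityTheory Set
open scoped ENNReal

noncomputable section

/-- The number of points of the random set `X` that lie in `B`. -/
def pointCount {Ω : Type*} (X : Ω → Set ℝ) (B : Set ℝ) (ω : Ω) : ℕ∞ :=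
  (X ω ∩ B).encard

/-- The Poisson distribution with mean `r ∈ [0, ∞]`, as a measure on `{0, 1, 2, …, ∞}`. For
`r = ∞` it is, by the usual convention, the point mass at `∞`. -/
def extPoisson (r : ℝ≥0∞) : Measure ℕ∞ :=
  if r = ∞ then Measure.dirac ⊤ else (poissonMeasure r.toNNReal).map (Nat.cast : ℕ → ℕ∞)

/-- The measure `Λ(B) = ∫_B lam(t) dt` of a nonnegative intensity function `lam`. -/
def meanMeasure (lam : ℝ → ℝ) (B : Set ℝ) : ℝ≥0∞ :=
  ∫⁻ t in B, ENNReal.ofReal (lam t)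

/-- `X` is an inhomogeneous Poisson point process on the real line with intensity function `lam`:
a random locally finite set of points whose counts on disjoint Borel sets are independent, the
count on `B` being Poisson with mean `Λ(B)`. -/
structure IsPoissonPointProcess {Ω : Type*} [MeasurableSpace Ω] (μ : Measure Ω)
    (X : Ω → Set ℝ) (lam : ℝ → ℝ) : Prop where
  locallyFinite : ∀ ω a b, (X ω ∩ Icc a b).Finite
  measurable_count : ∀ B, MeasurableSet B → Measurable (pointCount X B)
  hasLaw_count : ∀ B, MeasurableSet B →
    HasLaw (pointCount X B) (extPoisson (meanMeasure lam B)) μ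
  indep_count : ∀ B : ℕ → Set ℝ, (∀ k, MeasurableSet (B k)) →
    Pairwise (fun k l => Disjoint (B k) (B l)) → iIndepFun (fun k => pointCount X (B k)) μ

/-- The σ-algebra generated by the counts of `X` on the Borel subsets of `S`. -/
@[reducible] def processSigma {Ω : Type*} (X : Ω → Set ℝ) (S : Set ℝ) : MeasurableSpace Ω :=
  ⨆ (B : Set ℝ) (_ : MeasurableSet B) (_ : B ⊆ S),
    MeasurableSpace.comap (pointCount X B) inferInstance

/-- `x` is the point number `n` of the set `S` strictly after time `t`, counted from `n = 0`; so
`n = 0` is the next point after `t`. -/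
def IsNthPointAfter (S : Set ℝ) (t : ℝ) (n : ℕ) (x : ℝ) : Prop :=
  x ∈ S ∧ t < x ∧ (S ∩ Ioo t x).encard = n

/-- The event that the union of the processes has a point number `n` after time `t`. -/
def nthPointExists {Ω ι : Type*} (X : ι → Ω → Set ℝ) (t : ℝ) (n : ℕ) : Set Ω :=
  {ω | ∃ x, IsNthPointAfter (⋃ j, X j ω) t n x}

/-- The event that point number `n` after time `t` of the union of the processes exists and has
mark `i`, that is, it is a point of process `i`. -/
def nthPointHasMark {Ω ι : Type*} (X : ι → Ω → Set ℝ) (t : ℝ) (n : ℕ) (i : ι) : Set Ω :=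
  {ω | ∃ x ∈ X i ω, IsNthPointAfter (⋃ j, X j ω) t n x}

/-- The mark of point number `n` after time `t`, coded as the vector with entry `1` at the
mark and `0` elsewhere. -/
def markVector {Ω ι : Type*} (X : ι → Ω → Set ℝ) (t : ℝ) (n : ℕ) (ω : Ω) : ι → ℕ :=
  fun i => (nthPointHasMark X t n i).indicator (fun _ => 1) ω

/-- The history of all processes up to and including time `t`, together with the times and
marks of the first `n` points after `t`. For `n = 0` this is the history at time `t`; for `n ≥ 1`
it is what is known immediately after the `n`-th point following `t`. -/
@[reducible] def history {Ω ι : Type*} (X : ι → Ω → Set ℝ) (t : ℝ) (n : ℕ) : MeasurableSpace Ω :=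
  (⨆ i, processSigma (X i) (Iic t)) ⊔
    MeasurableSpace.generateFrom {E | ∃ k < n, ∃ (i : ι) (s : ℝ),
      E = {ω | ∃ x ∈ X i ω, x ≤ s ∧ IsNthPointAfter (⋃ j, X j ω) t k x}}

/-- `θ_i = ρ_i e^{δ_i} / ∑_j ρ_j e^{δ_j}`. -/
def softmaxWeight {d : ℕ} (ρ δ : Fin d → ℝ) (i : Fin d) : ℝ :=
  ρ i * Real.exp (δ i) / ∑ j, ρ j * Real.exp (δ j)

/-- The `Multinomial(1, θ)` distribution: the `i`-th unit vector has probability `θ_i`. -/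
def multinomialOne {d : ℕ} (θ : Fin d → ℝ) : Measure (Fin d → ℕ) :=
  ∑ i, ENNReal.ofReal (θ i) • Measure.dirac (Pi.single i 1)

end

/-! Put `c i = ρ i * exp (δ i)`, so that process `i` has intensity `c i * lam`. Cut `(t, ∞)` into
cells of mesh `h`. For a history event `A`, the event "`A`, and exactly `n` points lie between `t`
and the left end of the cell" is known at that left end (`measurableSet_history_inter`), hence
independent of what the cell contains (`indep_jointSigma`). A cell with mean `M` holds a single
point, of mark `i`, with probability `c i * M * ∏ j, exp (-(c j * M))`, where `i` enters only
through `c i`. Summing over cells gives `c i * K` with `K` the same for all marks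
(`exists_measure_iUnion_meshMark_eq`).

Almost surely no two processes share a point after `t` (`measure_common_point_Ioc_eq_zero`), so a
fine enough mesh isolates the point number `n` in its cell (`eventually_mem_iUnion_meshMark_iff`).
As the mesh shrinks, the proportionality passes to the true mark events, and summing over marks
gives (a), in `measure_inter_nthPointHasMark`.

For (b), a process with positive rate has infinitely many points after `t`. The earlier marks belong
to the history, so (a) splits off the latest mark from any finite set of marks, and induction gives
independence. -/

open Filter Topology

/-! ### Generated σ-algebras -/

/-- The σ-algebra generated by the counts of all the processes on the Borel subsets of `S`. -/
@[reducible] noncomputable def jointSigma {Ω ι : Type*} (X : ι → Ω → Set ℝ) (S : Set ℝ) : MeasurableSpace Ω :=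
  ⨆ i, processSigma (X i) S

theorem measurable_pointCount_processSigma {Ω : Type*} (X : Ω → Set ℝ) {S B : Set ℝ}
    (hB : MeasurableSet B) (hBS : B ⊆ S) : Measurable[processSigma X S] (pointCount X B) := by
  rw [measurable_iff_comap_le]
  exact le_iSup_of_le B (le_iSup_of_le hB (le_iSup_of_le hBS le_rfl))

theorem processSigma_le_iff {Ω : Type*} {X : Ω → Set ℝ} {S : Set ℝ} {m : MeasurableSpace Ω} :
    processSigma X S ≤ m ↔
      ∀ B, MeasurableSet B → B ⊆ S → Measurable[m] (pointCount X B) := by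
  simp only [processSigma, iSup_le_iff, measurable_iff_comap_le]

theorem processSigma_mono {Ω : Type*} (X : Ω → Set ℝ) {S T : Set ℝ} (h : S ⊆ T) :
    processSigma X S ≤ processSigma X T :=
  processSigma_le_iff.2 fun _ hB hBS ↦ measurable_pointCount_processSigma X hB (hBS.trans h)

theorem jointSigma_mono {Ω ι : Type*} (X : ι → Ω → Set ℝ) {S T : Set ℝ} (h : S ⊆ T) :
    jointSigma X S ≤ jointSigma X T :=
  iSup_mono fun i ↦ processSigma_mono (X i) h

theorem measurable_pointCount_jointSigma {Ω ι : Type*} (X : ι → Ω → Set ℝ) (i : ι) {S B : Set ℝ}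
    (hB : MeasurableSet B) (hBS : B ⊆ S) : Measurable[jointSigma X S] (pointCount (X i) B) :=
  (measurable_pointCount_processSigma (X i) hB hBS).mono
    (le_iSup (fun i ↦ processSigma (X i) S) i) le_rfl

theorem measurableSet_inter_nonempty {Ω ι : Type*} (X : ι → Ω → Set ℝ) (i : ι) {S B : Set ℝ}
    (hB : MeasurableSet B) (hBS : B ⊆ S) :
    MeasurableSet[jointSigma X S] {ω | (X i ω ∩ B).Nonempty} := by
  have : {ω | (X i ω ∩ B).Nonempty} = pointCount (X i) B ⁻¹' {0}ᶜ := by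
    ext ω
    simp [pointCount, nonempty_iff_ne_empty]
  rw [this]
  exact measurable_pointCount_jointSigma X i hB hBS (measurableSet_singleton _).compl

/-! ### Locally finite sets and measurability of the `n`-th point -/

/-- Above every point there is a gap without points of a locally finite set. -/
theorem exists_Ioo_right_eq_empty {U : Set ℝ} (hU : ∀ a b, (U ∩ Icc a b).Finite) {x y : ℝ}
    (hxy : x < y) : ∃ r, x < r ∧ r < y ∧ U ∩ Ioc x r = ∅ := by
  have hfin : (U ∩ Ioc x y).Finite := (hU x y).subset (by gcongr; exact Ioc_subset_Icc_self)
  rcases (U ∩ Ioc x y).eq_empty_or_nonempty with h | h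
  · obtain ⟨r, h1, h2⟩ := exists_between hxy
    exact ⟨r, h1, h2, subset_empty_iff.1 fun z hz ↦ h.subset ⟨hz.1, hz.2.1, hz.2.2.trans h2.le⟩⟩
  · obtain ⟨z, hz, hmin⟩ := hfin.exists_minimal h
    obtain ⟨r, h1, h2⟩ := exists_between hz.2.1
    refine ⟨r, h1, h2.trans_le hz.2.2, subset_empty_iff.1 fun w hw ↦ ?_⟩
    have hwr : w < z := hw.2.2.trans_lt h2
    exact absurd (hmin ⟨hw.1, hw.2.1, hwr.le.trans hz.2.2⟩ hwr.le) (not_le.2 hwr)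

/-- Below every point there is a gap without points of a locally finite set. -/
theorem exists_Ioo_left_eq_empty {U : Set ℝ} (hU : ∀ a b, (U ∩ Icc a b).Finite) {x y : ℝ}
    (hxy : x < y) : ∃ r, x < r ∧ r < y ∧ U ∩ Ioo r y = ∅ := by
  have hfin : (U ∩ Ioo x y).Finite := (hU x y).subset (by gcongr; exact Ioo_subset_Icc_self)
  rcases (U ∩ Ioo x y).eq_empty_or_nonempty with h | h
  · obtain ⟨r, h1, h2⟩ := exists_between hxy
    exact ⟨r, h1, h2, subset_empty_iff.1 fun z hz ↦ h.subset ⟨hz.1, h1.trans hz.2.1, hz.2.2⟩⟩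
  · obtain ⟨z, hz, hmax⟩ := hfin.exists_maximal h
    obtain ⟨r, h1, h2⟩ := exists_between hz.2.2
    refine ⟨r, hz.2.1.trans h1, h2, subset_empty_iff.1 fun w hw ↦ ?_⟩
    have hwr : z < w := h1.trans hw.2.1
    exact absurd (hmax ⟨hw.1, hz.2.1.trans hwr, hw.2.2⟩ hwr.le) (not_le.2 hwr)

theorem locallyFinite_iUnion {ι : Type*} [Finite ι] {X : ι → Set ℝ}
    (hX : ∀ i a b, (X i ∩ Icc a b).Finite) (a b : ℝ) : ((⋃ i, X i) ∩ Icc a b).Finite := by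
  rw [iUnion_inter]
  exact finite_iUnion fun i ↦ hX i a b

theorem finite_inter_Ioc {U : Set ℝ} (hU : ∀ a b, (U ∩ Icc a b).Finite) (a b : ℝ) :
    (U ∩ Ioc a b).Finite :=
  (hU a b).subset (by gcongr; exact Ioc_subset_Icc_self)

/-- This replaces the random end `x` of an interval by a deterministic one, either a rational or the
left end of a mesh cell. -/
theorem inter_Ioc_eq_inter_Ioo {U : Set ℝ} {t q x : ℝ} (hqx : q < x) (h : U ∩ Ioo q x = ∅) :
    U ∩ Ioc t q = U ∩ Ioo t x := by
  ext z
  constructor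
  · rintro ⟨hz, hz1, hz2⟩
    exact ⟨hz, hz1, hz2.trans_lt hqx⟩
  · rintro ⟨hz, hz1, hz2⟩
    refine ⟨hz, hz1, not_lt.1 fun hqz ↦ ?_⟩
    exact h.subset ⟨hz, hqz, hz2⟩

/-- An interval holds at least `k + 1` points exactly when a rational cut leaves at least `k` points
to the left and at least one point to the right. -/
theorem add_one_le_encard_iff {U : Set ℝ} (hU : ∀ a b, (U ∩ Icc a b).Finite) (k : ℕ) (a b : ℝ) :
    ((k + 1 : ℕ) : ℕ∞) ≤ (U ∩ Ioc a b).encard ↔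
      ∃ q : ℚ, a < q ∧ (q : ℝ) < b ∧ (k : ℕ∞) ≤ (U ∩ Ioc a q).encard ∧ (U ∩ Ioc (q : ℝ) b).Nonempty := by
  constructor
  · intro h
    have hne : (U ∩ Ioc a b).Nonempty := by
      rw [← encard_pos]
      exact lt_of_lt_of_le (by simp) h
    -- The cut goes just below the largest point `x`, so `x` is the only point lost on its left.
    obtain ⟨x, hx, hmax⟩ := (finite_inter_Ioc hU a b).exists_maximal hne
    obtain ⟨r, har, hrx, hr⟩ := exists_Ioo_left_eq_empty hU hx.2.1
    obtain ⟨q, hrq, hqx⟩ := exists_rat_btwn hrx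
    refine ⟨q, har.trans hrq, hqx.trans_le hx.2.2, ?_, x, hx.1, hqx, hx.2.2⟩
    have hsub : U ∩ Ioc a b ⊆ (U ∩ Ioc a q) ∪ {x} := by
      rintro z hz
      have hzx : z ≤ x := by
        rcases le_total z x with h | h
        · exact h
        · exact hmax hz h
      rcases hzx.eq_or_lt with h | h
      · exact Or.inr h
      · refine Or.inl ⟨hz.1, hz.2.1, not_lt.1 fun hqz ↦ hr.subset ⟨hz.1, hrq.trans hqz, h⟩⟩
    have := h.trans ((encard_le_encard hsub).trans (encard_union_le _ _))
    rw [encard_singleton, Nat.cast_add, Nat.cast_one] at this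
    exact (ENat.add_le_add_iff_right (by simp)).1 this
  · rintro ⟨q, haq, hqb, hk, x, hx, hqx, hxb⟩
    have hsub : (U ∩ Ioc a q) ∪ {x} ⊆ U ∩ Ioc a b := by
      rintro z (hz | rfl)
      · exact ⟨hz.1, hz.2.1, hz.2.2.trans hqb.le⟩
      · exact ⟨hx, haq.trans hqx, hxb⟩
    refine le_trans ?_ (encard_le_encard hsub)
    rw [encard_union_eq (by
      rw [disjoint_singleton_right]; exact fun hz ↦ absurd hz.2.2 (not_le.2 hqx)),
      encard_singleton, Nat.cast_add, Nat.cast_one]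
    gcongr

/-- Processes may share points, so the count of the union need not be the sum of the counts.
Rational cuts reduce it to countably many events that some `X j` meets an interval. -/
theorem measurableSet_le_encard_union {Ω ι : Type*} [Finite ι] {X : ι → Ω → Set ℝ}
    (hX : ∀ i ω a b, (X i ω ∩ Icc a b).Finite) {S : Set ℝ} (k : ℕ) (a b : ℝ) (h : Ioc a b ⊆ S) :
    MeasurableSet[jointSigma X S] {ω | (k : ℕ∞) ≤ ((⋃ j, X j ω) ∩ Ioc a b).encard} := by
  induction k generalizing b with
  | zero => simp
  | succ k ih =>
    have : {ω | ((k + 1 : ℕ) : ℕ∞) ≤ ((⋃ j, X j ω) ∩ Ioc a b).encard} =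
        ⋃ (q : ℚ) (_ : a < q ∧ (q : ℝ) < b), {ω | (k : ℕ∞) ≤ ((⋃ j, X j ω) ∩ Ioc a q).encard} ∩
          ⋃ j, {ω | (X j ω ∩ Ioc (q : ℝ) b).Nonempty} := by
      ext ω
      rw [mem_ofPred_eq, add_one_le_encard_iff (locallyFinite_iUnion fun i ↦ hX i ω)]
      simp only [mem_iUnion, mem_inter_iff, exists_prop, and_assoc, mem_ofPred_eq]
      simp only [iUnion_inter (Ioc _ b), nonempty_iUnion]
    rw [this]
    refine MeasurableSet.iUnion fun q ↦ MeasurableSet.iUnion fun hq ↦ (ih q ?_).inter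
      (MeasurableSet.iUnion fun j ↦ measurableSet_inter_nonempty X j measurableSet_Ioc ?_)
    · exact (Ioc_subset_Ioc_right hq.2.le).trans h
    · exact (Ioc_subset_Ioc_left hq.1.le).trans h

theorem measurableSet_encard_union_eq {Ω ι : Type*} [Finite ι] {X : ι → Ω → Set ℝ}
    (hX : ∀ i ω a b, (X i ω ∩ Icc a b).Finite) {S : Set ℝ} (k : ℕ) (a b : ℝ) (h : Ioc a b ⊆ S) :
    MeasurableSet[jointSigma X S] {ω | ((⋃ j, X j ω) ∩ Ioc a b).encard = k} := by
  have : {ω | ((⋃ j, X j ω) ∩ Ioc a b).encard = k} =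
      {ω | (k : ℕ∞) ≤ ((⋃ j, X j ω) ∩ Ioc a b).encard} \
        {ω | ((k + 1 : ℕ) : ℕ∞) ≤ ((⋃ j, X j ω) ∩ Ioc a b).encard} := by
    ext ω
    simp only [mem_ofPred_eq, Set.mem_sdiff, not_le, Nat.cast_add, Nat.cast_one]
    rw [ENat.lt_add_one_iff (by simp), and_comm]
    exact le_antisymm_iff
  rw [this]
  exact (measurableSet_le_encard_union hX k a b h).diff
    (measurableSet_le_encard_union hX (k + 1) a b h)

/-- The event that point number `k` after `t` is at most `s` and has mark `i` is known at time `s`. -/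
theorem measurableSet_nthPoint_le {Ω ι : Type*} [Finite ι] {X : ι → Ω → Set ℝ}
    (hX : ∀ i ω a b, (X i ω ∩ Icc a b).Finite) (t s : ℝ) (k : ℕ) (i : ι) :
    MeasurableSet[jointSigma X (Iic s)]
      {ω | ∃ x ∈ X i ω, x ≤ s ∧ IsNthPointAfter (⋃ j, X j ω) t k x} := by
  -- The point is isolated between rationals `q < x < r` with no other point in `(q, r]`. Truncating
  -- at `min r s` keeps all the events inside `Iic s`.
  have : {ω | ∃ x ∈ X i ω, x ≤ s ∧ IsNthPointAfter (⋃ j, X j ω) t k x} =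
      ⋃ (q : ℚ) (r : ℚ) (_ : t < q ∧ (q : ℝ) < s),
        {ω | ((⋃ j, X j ω) ∩ Ioc t q).encard = k} ∩
        ({ω | ((⋃ j, X j ω) ∩ Ioc (q : ℝ) (min r s)).encard = (1 : ℕ)} ∩
          {ω | (X i ω ∩ Ioc (q : ℝ) (min r s)).Nonempty}) := by
    ext ω
    have hU := locallyFinite_iUnion fun i ↦ hX i ω
    simp only [mem_ofPred_eq, mem_iUnion, mem_inter_iff, exists_prop]
    constructor
    · rintro ⟨x, hx, hxs, hxU, htx, hcard⟩
      obtain ⟨q', htq, hqx, hq'⟩ := exists_Ioo_left_eq_empty hU htx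
      obtain ⟨q, hq, hqx⟩ := exists_rat_btwn hqx
      obtain ⟨r', hxr, -, hr'⟩ := exists_Ioo_right_eq_empty hU (lt_add_one x)
      obtain ⟨r, hxr, hr⟩ := exists_rat_btwn hxr
      have hqe : (⋃ j, X j ω) ∩ Ioo (q : ℝ) x = ∅ :=
        subset_empty_iff.1 fun z hz ↦ hq'.subset ⟨hz.1, hq.trans hz.2.1, hz.2.2⟩
      refine ⟨q, r, ⟨htq.trans hq, hqx.trans_le hxs⟩, ?_, ?_, x, hx, hqx, le_min hxr.le hxs⟩
      · rw [inter_Ioc_eq_inter_Ioo hqx hqe, hcard]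
      · rw [Nat.cast_one, encard_eq_one]
        refine ⟨x, ?_⟩
        ext z
        constructor
        · rintro ⟨hz, hqz, hzr⟩
          rcases lt_trichotomy z x with h | h | h
          · exact (hqe.subset ⟨hz, hqz, h⟩).elim
          · exact h
          · exact (hr'.subset ⟨hz, h, (hzr.trans (min_le_left _ _)).trans hr.le⟩).elim
        · rintro rfl
          exact ⟨hxU, hqx, le_min hxr.le hxs⟩
    · rintro ⟨q, r, ⟨htq, hqs⟩, hk, h1, x, hx, hqx, hxr⟩
      have hxU : x ∈ ⋃ j, X j ω := mem_iUnion_of_mem i hx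
      refine ⟨x, hx, hxr.trans (min_le_right _ _), hxU, htq.trans hqx, ?_⟩
      rw [← inter_Ioc_eq_inter_Ioo hqx, hk]
      rw [Nat.cast_one, encard_eq_one] at h1
      obtain ⟨y, hy⟩ := h1
      have hxy : x = y := hy.subset ⟨hxU, hqx, hxr⟩
      refine subset_empty_iff.1 fun z hz ↦ ?_
      have : z = y := hy.subset ⟨hz.1, hz.2.1, hz.2.2.le.trans hxr⟩
      exact absurd hz.2.2 (by rw [this, hxy]; exact lt_irrefl _)
  rw [this]
  refine MeasurableSet.iUnion fun q ↦ MeasurableSet.iUnion fun r ↦ MeasurableSet.iUnion fun hq ↦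
    (measurableSet_encard_union_eq hX k t q ?_).inter
      ((measurableSet_encard_union_eq hX 1 q (min r s) ?_).inter
      (measurableSet_inter_nonempty X i measurableSet_Ioc ?_))
  · exact Ioc_subset_Iic_self.trans (Iic_subset_Iic.2 hq.2.le)
  · exact Ioc_subset_Iic_self.trans (Iic_subset_Iic.2 (min_le_right _ _))
  · exact Ioc_subset_Iic_self.trans (Iic_subset_Iic.2 (min_le_right _ _))

/-! ### Mark events and the history -/

theorem nthPointHasMark_eq_iUnion {Ω ι : Type*} (X : ι → Ω → Set ℝ) (t : ℝ) (k : ℕ) (i : ι) :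
    nthPointHasMark X t k i =
      ⋃ s : ℕ, {ω | ∃ x ∈ X i ω, x ≤ (s : ℝ) ∧ IsNthPointAfter (⋃ j, X j ω) t k x} := by
  ext ω
  simp only [nthPointHasMark, mem_ofPred_eq, mem_iUnion]
  constructor
  · rintro ⟨x, hx, h⟩
    obtain ⟨s, hs⟩ := exists_nat_ge x
    exact ⟨s, x, hx, hs, h⟩
  · rintro ⟨s, x, hx, -, h⟩
    exact ⟨x, hx, h⟩

theorem measurableSet_nthPointHasMark {Ω ι : Type*} [Finite ι] {X : ι → Ω → Set ℝ}
    (hX : ∀ i ω a b, (X i ω ∩ Icc a b).Finite) (t : ℝ) (k : ℕ) (i : ι) :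
    MeasurableSet[jointSigma X univ] (nthPointHasMark X t k i) := by
  rw [nthPointHasMark_eq_iUnion]
  exact MeasurableSet.iUnion fun s ↦ jointSigma_mono X (subset_univ _) _
    (measurableSet_nthPoint_le hX t s k i)

theorem measurableSet_history_nthPointHasMark {Ω ι : Type*} (X : ι → Ω → Set ℝ) (t : ℝ) {k n : ℕ}
    (hk : k < n) (i : ι) : MeasurableSet[history X t n] (nthPointHasMark X t k i) := by
  rw [nthPointHasMark_eq_iUnion]
  exact MeasurableSet.iUnion fun s ↦ (le_sup_right : _ ≤ history X t n) _
    (MeasurableSpace.measurableSet_generateFrom ⟨k, hk, i, s, rfl⟩)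

theorem nthPointExists_eq_iUnion {Ω ι : Type*} (X : ι → Ω → Set ℝ) (t : ℝ) (n : ℕ) :
    nthPointExists X t n = ⋃ i, nthPointHasMark X t n i := by
  ext ω
  simp only [nthPointExists, nthPointHasMark, mem_ofPred_eq, mem_iUnion]
  constructor
  · rintro ⟨x, hx⟩
    obtain ⟨i, hi⟩ := mem_iUnion.1 hx.1
    exact ⟨i, x, hi, hx⟩
  · rintro ⟨i, x, -, hx⟩
    exact ⟨x, hx⟩

theorem history_le {Ω ι : Type*} [Finite ι] {X : ι → Ω → Set ℝ}
    (hX : ∀ i ω a b, (X i ω ∩ Icc a b).Finite) (t : ℝ) (n : ℕ) :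
    history X t n ≤ jointSigma X univ := by
  refine sup_le (jointSigma_mono X (subset_univ _)) (MeasurableSpace.generateFrom_le ?_)
  rintro _ ⟨k, -, i, s, rfl⟩
  exact jointSigma_mono X (subset_univ _) _ (measurableSet_nthPoint_le hX t s k i)

/-- On the event that there are exactly `n` points in `(t, q]`, the history up to the `n`-th point is
known at time `q`. -/
theorem measurableSet_history_inter {Ω ι : Type*} [Finite ι] {X : ι → Ω → Set ℝ}
    (hX : ∀ i ω a b, (X i ω ∩ Icc a b).Finite) {t q : ℝ} (htq : t ≤ q) {n : ℕ} {A : Set Ω}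
    (hA : MeasurableSet[history X t n] A) :
    MeasurableSet[jointSigma X (Iic q)] (A ∩ {ω | ((⋃ j, X j ω) ∩ Ioc t q).encard = n}) := by
  have hN := measurableSet_encard_union_eq hX n t q (S := Iic q) Ioc_subset_Iic_self
  set N := {ω | ((⋃ j, X j ω) ∩ Ioc t q).encard = n} with hNdef
  -- The sets whose trace on `N` is known at time `q` form a σ-algebra, so it suffices to check the
  -- generators of the history.
  let m : MeasurableSpace Ω :=
    { MeasurableSet' := fun A ↦ MeasurableSet[jointSigma X (Iic q)] (A ∩ N)
      measurableSet_empty := by simp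
      measurableSet_compl := fun A hA ↦ by
        have : Aᶜ ∩ N = N \ (A ∩ N) := by ext; simp; tauto
        rw [this]
        exact hN.diff hA
      measurableSet_iUnion := fun f hf ↦ by
        rw [iUnion_inter]
        exact MeasurableSet.iUnion hf }
  suffices history X t n ≤ m from this A hA
  refine sup_le (fun A hA ↦ ?_) (MeasurableSpace.generateFrom_le ?_)
  · exact (jointSigma_mono X (Iic_subset_Iic.2 htq) A hA).inter hN
  · rintro _ ⟨k, hk, i, s, rfl⟩
    -- On `N`, point number `k < n` is at most `q`: otherwise all `n` points of `(t, q]` would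
    -- precede it. So the bound `s` may be lowered to `min s q`.
    have : {ω | ∃ x ∈ X i ω, x ≤ s ∧ IsNthPointAfter (⋃ j, X j ω) t k x} ∩ N =
        {ω | ∃ x ∈ X i ω, x ≤ min s q ∧ IsNthPointAfter (⋃ j, X j ω) t k x} ∩ N := by
      ext ω
      simp only [mem_inter_iff, mem_ofPred_eq, and_congr_left_iff]
      intro hω
      refine exists_congr fun x ↦ and_congr_right fun hx ↦ and_congr_left fun hnth ↦ ?_
      refine ⟨fun h ↦ le_min h (not_lt.1 fun hqx ↦ ?_), fun h ↦ h.trans (min_le_left _ _)⟩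
      have hω' : ((⋃ j, X j ω) ∩ Ioc t q).encard = n := hω
      have h1 : (n : ℕ∞) ≤ k := by
        rw [← hω', ← hnth.2.2]
        exact encard_le_encard fun z hz ↦ ⟨hz.1, hz.2.1, hz.2.2.trans_lt hqx⟩
      exact absurd (Nat.cast_le.1 h1) (not_le.2 hk)
    change MeasurableSet[jointSigma X (Iic q)] (_ ∩ N)
    rw [this]
    exact (jointSigma_mono X (Iic_subset_Iic.2 (min_le_right s q)) _
      (measurableSet_nthPoint_le hX t (min s q) k i)).inter hN

/-! ### Independence over disjoint sets -/

/-- The σ-algebra generated by the counts on the cells that a labelling `f` cuts out of `S`. -/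
@[reducible] noncomputable def cellSigma {Ω : Type*} (X : Ω → Set ℝ) (S : Set ℝ) (f : SimpleFunc ℝ ℕ) :
    MeasurableSpace Ω :=
  ⨆ v : ℕ, MeasurableSpace.comap (pointCount X (S ∩ f ⁻¹' {v})) inferInstance

theorem measurable_pointCount_cell {Ω : Type*} (X : Ω → Set ℝ) (S : Set ℝ) (f : SimpleFunc ℝ ℕ)
    (v : ℕ) : Measurable[cellSigma X S f] (pointCount X (S ∩ f ⁻¹' {v})) := by
  rw [measurable_iff_comap_le]
  exact le_iSup (fun v ↦ MeasurableSpace.comap (pointCount X (S ∩ f ⁻¹' {v})) inferInstance) v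

theorem pointCount_union {Ω : Type*} (X : Ω → Set ℝ) {B C : Set ℝ} (h : Disjoint B C) :
    pointCount X (B ∪ C) = fun ω ↦ pointCount X B ω + pointCount X C ω := by
  ext ω
  rw [pointCount, inter_union_distrib_left,
    encard_union_eq (h.mono inter_subset_right inter_subset_right)]
  rfl

theorem measurable_pointCount_biUnion {Ω κ : Type*} (X : Ω → Set ℝ) {m : MeasurableSpace Ω}
    (s : Finset κ) {B : κ → Set ℝ} (hB : Pairwise (Function.onFun Disjoint B))
    (h : ∀ k, Measurable (pointCount X (B k))) : Measurable (pointCount X (⋃ k ∈ s, B k)) := by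
  classical
  induction s using Finset.induction_on with
  | empty =>
    have : pointCount X (⋃ k ∈ (∅ : Finset κ), B k) = fun _ ↦ 0 := by ext; simp [pointCount]
    rw [this]
    exact measurable_const
  | insert k s hk ih =>
    rw [Finset.set_biUnion_insert, pointCount_union]
    · exact (Measurable.of_discrete (f := fun p : ℕ∞ × ℕ∞ ↦ p.1 + p.2)).comp ((h k).prodMk ih)
    · simp only [disjoint_iUnion_right]
      exact fun l hl ↦ hB (fun h ↦ hk (h ▸ hl))

/-- Each cell of `f` is a finite disjoint union of cells of `h`, and counts add over disjoint sets.
-/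
theorem cellSigma_le_of_factor {Ω : Type*} (X : Ω → Set ℝ) (S : Set ℝ) (f h : SimpleFunc ℝ ℕ)
    (g : ℕ → ℕ) (hfg : ∀ x, f x = g (h x)) : cellSigma X S f ≤ cellSigma X S h := by
  refine iSup_le fun v ↦ ?_
  rw [← measurable_iff_comap_le]
  have : S ∩ f ⁻¹' {v} = ⋃ w ∈ h.range.filter (fun w ↦ g w = v), S ∩ h ⁻¹' {w} := by
    ext x
    simp [hfg]
    exact fun _ ↦ ⟨fun h ↦ ⟨x, h, rfl⟩, fun ⟨y, h1, h2⟩ ↦ h2 ▸ h1⟩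
  rw [this]
  refine measurable_pointCount_biUnion X _ (fun w w' hw ↦ ?_) (measurable_pointCount_cell X S h)
  exact disjoint_left.2 fun x hx hx' ↦ hw (hx.2.symm.trans hx'.2)

/-- The paired labelling refines both. Directedness is what lets independence pass to the supremum.
-/
theorem directed_cellSigma {Ω : Type*} (X : Ω → Set ℝ) (S : Set ℝ) :
    Directed (· ≤ ·) (cellSigma X S) := fun f g ↦
  ⟨(f.pair g).map (fun p ↦ Nat.pair p.1 p.2),
    cellSigma_le_of_factor X S f _ (fun n ↦ n.unpair.1) (by simp),
    cellSigma_le_of_factor X S g _ (fun n ↦ n.unpair.2) (by simp)⟩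

theorem cellSigma_le {Ω : Type*} (X : Ω → Set ℝ) {S : Set ℝ} (hS : MeasurableSet S)
    (f : SimpleFunc ℝ ℕ) : cellSigma X S f ≤ processSigma X S := by
  refine iSup_le fun v ↦ ?_
  rw [← measurable_iff_comap_le]
  exact measurable_pointCount_processSigma X (hS.inter (f.measurableSet_fiber v)) inter_subset_left

theorem iSup_cellSigma {Ω : Type*} (X : Ω → Set ℝ) {S : Set ℝ} (hS : MeasurableSet S) :
    ⨆ f, cellSigma X S f = processSigma X S := by
  refine le_antisymm (iSup_le (cellSigma_le X hS)) (processSigma_le_iff.2 fun B hB hBS ↦ ?_)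
  classical
  let f : SimpleFunc ℝ ℕ :=
    SimpleFunc.piecewise B hB (SimpleFunc.const ℝ 1) (SimpleFunc.const ℝ 0)
  have : B = S ∩ f ⁻¹' {1} := by
    ext x
    by_cases hx : x ∈ B
    · simp [f, hx, hBS hx]
    · simp [f, hx]
  rw [this]
  exact (measurable_pointCount_cell X S f 1).mono (le_iSup (cellSigma X S) f) le_rfl

theorem IsPoissonPointProcess.processSigma_le {Ω : Type*} [mΩ : MeasurableSpace Ω] {μ : Measure Ω}
    {X : Ω → Set ℝ} {lam : ℝ → ℝ} (hX : IsPoissonPointProcess μ X lam) (S : Set ℝ) :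
    processSigma X S ≤ mΩ :=
  processSigma_le_iff.2 fun B hB _ ↦ hX.measurable_count B hB

theorem IsPoissonPointProcess.indep_cellSigma {Ω : Type*} [MeasurableSpace Ω] {μ : Measure Ω}
    {X : Ω → Set ℝ} {lam : ℝ → ℝ} (hX : IsPoissonPointProcess μ X lam) {S T : Set ℝ}
    (hS : MeasurableSet S) (hT : MeasurableSet T) (hST : Disjoint S T) (f g : SimpleFunc ℝ ℕ) :
    Indep (cellSigma X S f) (cellSigma X T g) μ := by
  -- `indep_count` speaks of one disjoint sequence, so both families of cells are interleaved: code
  -- `(0, v)` for the cells of `S`, `(1, v)` for those of `T`, and the empty set for all other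
  -- codes.
  let B : ℕ → Set ℝ := fun k ↦
    if k.unpair.1 = 0 then S ∩ f ⁻¹' {k.unpair.2} else
      if k.unpair.1 = 1 then T ∩ g ⁻¹' {k.unpair.2} else ∅
  have hBm : ∀ k, MeasurableSet (B k) := fun k ↦ by
    simp only [B]
    split_ifs
    exacts [hS.inter (f.measurableSet_fiber _), hT.inter (g.measurableSet_fiber _), .empty]
  have hBd : Pairwise (fun k l ↦ Disjoint (B k) (B l)) := by
    intro k l hkl
    refine disjoint_left.2 fun x hx hx' ↦ hkl ?_
    rw [← Nat.pair_unpair k, ← Nat.pair_unpair l]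
    simp only [B] at hx hx'
    split_ifs at hx hx' with h1 h2 h3 h4 h5 h6 h7
    · rw [h1, h2, ← hx.2, ← hx'.2]
    · exact (disjoint_left.1 hST hx.1 hx'.1).elim
    · exact hx'.elim
    · exact (disjoint_left.1 hST hx'.1 hx.1).elim
    · rw [h4, h6, ← hx.2, ← hx'.2]
    · exact hx'.elim
    all_goals exact hx.elim
  have hind := hX.indep_count B hBm hBd
  have key := indep_iSup_of_disjoint
    (fun k ↦ (hX.measurable_count (B k) (hBm k)).comap_le) hind
    (S := {k | k.unpair.1 = 0}) (T := {k | k.unpair.1 = 1})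
    (disjoint_left.2 fun k hk hk' ↦ by simp_all)
  refine indep_of_indep_of_le_left (indep_of_indep_of_le_right key ?_) ?_
  · refine iSup_le fun v ↦ le_iSup₂_of_le (Nat.pair 1 v) (by simp) ?_
    simp [B]
  · refine iSup_le fun v ↦ le_iSup₂_of_le (Nat.pair 0 v) (by simp) ?_
    simp [B]

/-- A Poisson process on disjoint sets gives independent σ-algebras. -/
theorem IsPoissonPointProcess.indep_processSigma {Ω : Type*} [MeasurableSpace Ω] {μ : Measure Ω}
    [IsProbabilityMeasure μ]
    {X : Ω → Set ℝ} {lam : ℝ → ℝ} (hX : IsPoissonPointProcess μ X lam) {S T : Set ℝ}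
    (hS : MeasurableSet S) (hT : MeasurableSet T) (hST : Disjoint S T) :
    Indep (processSigma X S) (processSigma X T) μ := by
  -- Independence passes to a directed supremum, first for `S` and then for `T`.
  rw [← iSup_cellSigma X hS]
  refine indep_iSup_of_directed_le (fun f ↦ Indep.symm ?_)
    (fun f ↦ (cellSigma_le X hS f).trans (hX.processSigma_le S)) (hX.processSigma_le T)
    (directed_cellSigma X S)
  rw [← iSup_cellSigma X hT]
  exact indep_iSup_of_directed_le (fun g ↦ (hX.indep_cellSigma hS hT hST f g).symm)
    (fun g ↦ (cellSigma_le X hT g).trans (hX.processSigma_le T))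
    ((cellSigma_le X hS f).trans (hX.processSigma_le S)) (directed_cellSigma X T)

/-- Refining each member of an independent family into two independent parts gives an independent
family. -/
theorem iIndep.sum_of_indep {Ω ι : Type*} [Fintype ι] [mΩ : MeasurableSpace Ω] {μ : Measure Ω}
    {m m₁ m₂ : ι → MeasurableSpace Ω} (h : iIndep m μ) (h₁ : ∀ i, m₁ i ≤ m i) (h₂ : ∀ i, m₂ i ≤ m i)
    (h₁₂ : ∀ i, Indep (m₁ i) (m₂ i) μ) : iIndep (Sum.elim m₁ m₂) μ := by
  classical
  rw [iIndep_iff]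
  intro s f hf
  -- Padding with `univ` turns the product over `s` into one over all of `ι ⊕ ι`, which splits into
  -- pairs indexed by `ι`.
  let g : ι ⊕ ι → Set Ω := fun k ↦ if k ∈ s then f k else univ
  have hg : ∀ k, MeasurableSet[Sum.elim m₁ m₂ k] (g k) := fun k ↦ by
    simp only [g]
    split_ifs with hk
    exacts [hf k hk, .univ]
  have e1 : ⋂ k ∈ s, f k = ⋂ i ∈ (Finset.univ : Finset ι), (g (.inl i) ∩ g (.inr i)) := by
    ext ω
    simp only [g, mem_iInter, Finset.mem_univ, mem_inter_iff, true_implies]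
    constructor
    · intro H i
      constructor <;> split_ifs with hk <;> first | exact H _ hk | trivial
    · rintro H (i | i) hi
      · simpa [hi] using (H i).1
      · simpa [hi] using (H i).2
  have e2 : ∏ k ∈ s, μ (f k) = ∏ k, μ (g k) := by
    have := h.isProbabilityMeasure
    rw [← Finset.prod_subset (Finset.subset_univ s) (fun k _ hk ↦ by simp [g, hk])]
    exact Finset.prod_congr rfl fun k hk ↦ by simp [g, hk]
  rw [e1, e2, Fintype.prod_sum_type, ← Finset.prod_mul_distrib, (iIndep_iff m μ).1 h Finset.univ
    (fun i _ ↦ (h₁ i _ (hg (.inl i))).inter (h₂ i _ (hg (.inr i))))]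
  exact Finset.prod_congr rfl fun i _ ↦ (Indep_iff _ _ μ).1 (h₁₂ i) _ _ (hg (.inl i)) (hg (.inr i))

/-- The σ-algebras of all `X i` on `S` and on `T` form one independent family; grouping the `S`
members against the `T` members gives the result. -/
theorem indep_jointSigma {Ω ι : Type*} [Fintype ι] [mΩ : MeasurableSpace Ω] {μ : Measure Ω}
    [IsProbabilityMeasure μ] {X : ι → Ω → Set ℝ} {lam : ι → ℝ → ℝ}
    (hX : ∀ i, IsPoissonPointProcess μ (X i) (lam i))
    (hX_indep : iIndep (fun i ↦ processSigma (X i) univ) μ) {S T : Set ℝ}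
    (hS : MeasurableSet S) (hT : MeasurableSet T) (hST : Disjoint S T) :
    Indep (jointSigma X S) (jointSigma X T) μ := by
  have h := iIndep.sum_of_indep hX_indep (fun i ↦ processSigma_mono (X i) (subset_univ S))
    (fun i ↦ processSigma_mono (X i) (subset_univ T))
    (fun i ↦ (hX i).indep_processSigma hS hT hST)
  have key := indep_iSup_of_disjoint (by
      rintro (i | i)
      exacts [(hX i).processSigma_le S, (hX i).processSigma_le T]) h
    (S := range Sum.inl) (T := range Sum.inr) isCompl_range_inl_range_inr.disjoint
  simpa only [iSup_range, Sum.elim_inl, Sum.elim_inr] using key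

/-! ### Poisson probabilities and mean measures -/

theorem extPoisson_singleton {r : ℝ≥0∞} (hr : r ≠ ∞) (n : ℕ) :
    extPoisson r {(n : ℕ∞)} = ENNReal.ofReal (Real.exp (-r.toReal) * r.toReal ^ n / n.factorial) := by
  rw [extPoisson, if_neg hr, Measure.map_apply .of_discrete (measurableSet_singleton _)]
  have : (Nat.cast : ℕ → ℕ∞) ⁻¹' {(n : ℕ∞)} = {n} := by ext; simp
  rw [this, poissonMeasure_singleton]
  rfl

theorem IsPoissonPointProcess.measure_pointCount_eq {Ω : Type*} [MeasurableSpace Ω] {μ : Measure Ω}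
    {X : Ω → Set ℝ} {lam : ℝ → ℝ} (hX : IsPoissonPointProcess μ X lam) {B : Set ℝ}
    (hB : MeasurableSet B) (hfin : meanMeasure lam B ≠ ∞) (n : ℕ) :
    μ {ω | pointCount X B ω = n} = ENNReal.ofReal (Real.exp (-(meanMeasure lam B).toReal) *
      (meanMeasure lam B).toReal ^ n / n.factorial) := by
  rw [← extPoisson_singleton hfin]
  exact (hX.hasLaw_count B hB).measure_eq (p := fun x ↦ x = n) (measurableSet_singleton _)

/-- This is `1 - exp (-M) ≤ M`. -/
theorem IsPoissonPointProcess.measure_inter_nonempty_le {Ω : Type*} [MeasurableSpace Ω]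
    {μ : Measure Ω} [IsProbabilityMeasure μ]
    {X : Ω → Set ℝ} {lam : ℝ → ℝ} (hX : IsPoissonPointProcess μ X lam) {B : Set ℝ}
    (hB : MeasurableSet B) : μ {ω | (X ω ∩ B).Nonempty} ≤ meanMeasure lam B := by
  by_cases hfin : meanMeasure lam B = ∞
  · simp [hfin]
  have h0 := hX.measure_pointCount_eq hB hfin 0
  have hm : MeasurableSet {ω | pointCount X B ω = (0 : ℕ)} :=
    hX.measurable_count B hB (measurableSet_singleton _)
  have : {ω | (X ω ∩ B).Nonempty} = {ω | pointCount X B ω = (0 : ℕ)}ᶜ := by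
    ext ω
    simp [pointCount, nonempty_iff_ne_empty]
  rw [this, measure_compl hm (measure_ne_top _ _), h0, measure_univ]
  simp only [pow_zero, mul_one, Nat.factorial_zero, Nat.cast_one, div_one]
  rw [tsub_le_iff_right, ← ENNReal.ofReal_toReal hfin,
    ← ENNReal.ofReal_add (by positivity) (by positivity), ← ENNReal.ofReal_one]
  refine ENNReal.ofReal_le_ofReal ?_
  rw [ENNReal.toReal_ofReal (by positivity)]
  linarith [Real.add_one_le_exp (-(meanMeasure lam B).toReal)]

theorem meanMeasure_const_mul {c : ℝ} (hc : 0 ≤ c) (lam : ℝ → ℝ) (B : Set ℝ) :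
    meanMeasure (fun t ↦ c * lam t) B = ENNReal.ofReal c * meanMeasure lam B := by
  simp only [meanMeasure, ENNReal.ofReal_mul hc]
  exact lintegral_const_mul' _ _ ENNReal.ofReal_ne_top

theorem meanMeasure_mono (lam : ℝ → ℝ) {B C : Set ℝ} (h : B ⊆ C) :
    meanMeasure lam B ≤ meanMeasure lam C :=
  lintegral_mono_set h

theorem meanMeasure_Ioc_ne_top {lam : ℝ → ℝ} (h : LocallyIntegrable lam volume) (a b : ℝ) :
    meanMeasure lam (Ioc a b) ≠ ∞ := by
  refine ne_top_of_le_ne_top ?_ (meanMeasure_mono lam Ioc_subset_Icc_self)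
  have := (h.integrableOn_isCompact (isCompact_Icc (a := a) (b := b))).lintegral_lt_top
  exact this.ne

/-! ### Meshes and the absence of common points -/

/-- The cell number `k` of mesh `h` after time `t`. -/
def meshCell (t h : ℝ) (k : ℕ) : Set ℝ := Ioc (t + k * h) (t + (k + 1) * h)

theorem measurableSet_meshCell (t h : ℝ) (k : ℕ) : MeasurableSet (meshCell t h k) :=
  measurableSet_Ioc

theorem pairwise_disjoint_meshCell (t : ℝ) {h : ℝ} (hh : 0 < h) :
    Pairwise (Function.onFun Disjoint (meshCell t h)) := by
  intro k l hkl
  wlog hlt : k < l generalizing k l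
  · exact (this hkl.symm (lt_of_le_of_ne (not_lt.1 hlt) hkl.symm)).symm
  refine disjoint_left.2 fun x hx hx' ↦ ?_
  have h1 : ((k : ℝ) + 1) * h ≤ l * h := by
    gcongr
    exact_mod_cast hlt
  linarith [hx.2, hx'.1]

theorem exists_mem_meshCell {t h x : ℝ} (hh : 0 < h) (hx : t < x) : ∃ k, x ∈ meshCell t h k := by
  have hpos : 0 < (x - t) / h := div_pos (sub_pos.2 hx) hh
  obtain ⟨k, hk⟩ := Nat.exists_eq_succ_of_ne_zero (Nat.ceil_pos.2 hpos).ne'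
  refine ⟨k, ?_, ?_⟩
  · have := (Nat.lt_ceil (n := k)).1 (by omega : k < ⌈(x - t) / h⌉₊)
    rw [lt_div_iff₀ hh] at this
    linarith
  · have := Nat.le_ceil ((x - t) / h)
    rw [hk, div_le_iff₀ hh] at this
    push_cast at this
    linarith

theorem meanMeasure_iUnion {lam : ℝ → ℝ} {B : ℕ → Set ℝ} (hB : ∀ k, MeasurableSet (B k))
    (hd : Pairwise (Function.onFun Disjoint B)) :
    meanMeasure lam (⋃ k, B k) = ∑' k, meanMeasure lam (B k) :=
  lintegral_iUnion hB hd _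

/-- Two independent Poisson processes with locally finite mean measures have no common point in a
bounded interval. -/
theorem measure_common_point_Ioc_eq_zero {Ω : Type*} [MeasurableSpace Ω] {μ : Measure Ω}
    [IsProbabilityMeasure μ] {X Y : Ω → Set ℝ} {lam lam' : ℝ → ℝ}
    (hX : IsPoissonPointProcess μ X lam) (hY : IsPoissonPointProcess μ Y lam')
    (hXY : Indep (processSigma X univ) (processSigma Y univ) μ) {a b : ℝ}
    (hfin : meanMeasure lam (Ioc a b) ≠ ∞) (hfin' : meanMeasure lam' (Ioc a b) ≠ ∞) :
    μ {ω | (X ω ∩ Y ω ∩ Ioc a b).Nonempty} = 0 := by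
  refine le_antisymm (ENNReal.le_of_forall_pos_le_add fun ε hε _ ↦ ?_) zero_le
  rw [zero_add]
  -- The `+ 1` in the witness avoids dividing by zero when the mean vanishes.
  obtain ⟨η, hη, hηε⟩ : ∃ η : ℝ≥0∞, η ≠ 0 ∧ η * meanMeasure lam' (Ioc a b) ≤ ε := by
    refine ⟨ε / (meanMeasure lam' (Ioc a b) + 1), ?_, ?_⟩
    · exact (ENNReal.div_pos (by exact_mod_cast hε.ne') (by finiteness)).ne'
    · calc _ ≤ ε / (meanMeasure lam' (Ioc a b) + 1) * (meanMeasure lam' (Ioc a b) + 1) := by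
            gcongr
            exact le_self_add
        _ ≤ ε := (ENNReal.div_mul_cancel (by simp) (by finiteness)).le
  -- By absolute continuity of the integral, every sufficiently short cell has mean at most `η` for
  -- `lam`.
  obtain ⟨δ, hδ, H⟩ := exists_pos_setLIntegral_lt_of_measure_lt hfin hη
  obtain ⟨h, hh, hhδ⟩ : ∃ h : ℝ, 0 < h ∧ ENNReal.ofReal h < δ := by
    obtain ⟨h, hh, hhδ⟩ := ENNReal.lt_iff_exists_nnreal_btwn.1 hδ
    exact ⟨h, by exact_mod_cast hh, by simpa using hhδ⟩
  let B : ℕ → Set ℝ := fun k ↦ meshCell a h k ∩ Ioc a b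
  have hB : ∀ k, MeasurableSet (B k) := fun k ↦ (measurableSet_meshCell a h k).inter measurableSet_Ioc
  have hBd : Pairwise (Function.onFun Disjoint B) := fun k l hkl ↦
    (pairwise_disjoint_meshCell a hh hkl).mono inter_subset_left inter_subset_left
  have hsmall : ∀ k, meanMeasure lam (B k) ≤ η := fun k ↦ by
    have h1 := H (meshCell a h k) (by
      refine (Measure.restrict_apply_le _ _).trans_lt ?_
      rw [meshCell, Real.volume_Ioc]
      convert hhδ using 2
      ring)
    rw [Measure.restrict_restrict (measurableSet_meshCell a h k)] at h1
    exact h1.le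
  have hne : ∀ (Z : Ω → Set ℝ) (k : ℕ),
      MeasurableSet[processSigma Z univ] {ω | (Z ω ∩ B k).Nonempty} := fun Z k ↦ by
    have : {ω | (Z ω ∩ B k).Nonempty} = pointCount Z (B k) ⁻¹' {0}ᶜ := by
      ext ω
      simp [pointCount, nonempty_iff_ne_empty]
    rw [this]
    exact measurable_pointCount_processSigma Z (hB k) (subset_univ _) (measurableSet_singleton _).compl
  calc μ {ω | (X ω ∩ Y ω ∩ Ioc a b).Nonempty}
      ≤ μ (⋃ k, {ω | (X ω ∩ B k).Nonempty} ∩ {ω | (Y ω ∩ B k).Nonempty}) := by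
        refine measure_mono ?_
        rintro ω ⟨x, ⟨hx, hy⟩, hxI⟩
        obtain ⟨k, hk⟩ := exists_mem_meshCell hh hxI.1
        exact mem_iUnion.2 ⟨k, ⟨x, hx, hk, hxI⟩, ⟨x, hy, hk, hxI⟩⟩
    _ ≤ ∑' k, μ ({ω | (X ω ∩ B k).Nonempty} ∩ {ω | (Y ω ∩ B k).Nonempty}) := measure_iUnion_le _
    -- A common point makes both processes hit one cell; by independence this costs a product of two
    -- means, one of them at most `η`.
    _ ≤ ∑' k, η * meanMeasure lam' (B k) := by
        refine ENNReal.tsum_le_tsum fun k ↦ ?_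
        rw [(Indep_iff _ _ μ).1 hXY _ _ (hne X k) (hne Y k)]
        exact mul_le_mul' ((hX.measure_inter_nonempty_le (hB k)).trans (hsmall k))
          (hY.measure_inter_nonempty_le (hB k))
    _ = η * meanMeasure lam' (⋃ k, B k) := by
        rw [ENNReal.tsum_mul_left, meanMeasure_iUnion hB hBd]
    _ ≤ η * meanMeasure lam' (Ioc a b) := by
        gcongr
        exact meanMeasure_mono _ (iUnion_subset fun k ↦ inter_subset_right)
    _ ≤ ε := hηε

theorem ae_disjoint_Ioi {Ω ι : Type*} [Countable ι] [MeasurableSpace Ω] {μ : Measure Ω}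
    [IsProbabilityMeasure μ] {X : ι → Ω → Set ℝ} {lam : ι → ℝ → ℝ}
    (hX : ∀ i, IsPoissonPointProcess μ (X i) (lam i))
    (hX_indep : iIndep (fun i ↦ processSigma (X i) univ) μ)
    (hfin : ∀ i a b, meanMeasure (lam i) (Ioc a b) ≠ ∞) (t : ℝ) :
    ∀ᵐ ω ∂μ, ∀ i j, i ≠ j → ∀ x, t < x → x ∈ X i ω → x ∉ X j ω := by
  simp only [ae_all_iff]
  intro i j hij
  have h : ∀ n : ℕ, ∀ᵐ ω ∂μ, ¬(X i ω ∩ X j ω ∩ Ioc t n).Nonempty := fun n ↦ by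
    rw [ae_iff]
    simpa only [not_not] using measure_common_point_Ioc_eq_zero (hX i) (hX j) (hX_indep.indep hij)
      (hfin i t n) (hfin j t n)
  filter_upwards [ae_all_iff.2 h] with ω hω x htx hxi hxj
  obtain ⟨n, hn⟩ := exists_nat_ge x
  exact hω n ⟨x, ⟨hxi, hxj⟩, htx, hn⟩

/-! ### Detecting the mark of the `n`-th point with a mesh -/

/-- The event that `B` holds exactly one point of process `i` and no point of the others. -/
def singlePoint {Ω ι : Type*} (X : ι → Ω → Set ℝ) (i : ι) (B : Set ℝ) : Set Ω :=
  {ω | pointCount (X i) B ω = 1 ∧ ∀ j ≠ i, pointCount (X j) B ω = 0}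

theorem singlePoint_eq_iInter {Ω ι : Type*} [DecidableEq ι] (X : ι → Ω → Set ℝ) (i : ι)
    (B : Set ℝ) :
    singlePoint X i B = ⋂ j, {ω | pointCount (X j) B ω = ((if j = i then 1 else 0 : ℕ) : ℕ∞)} := by
  ext ω
  simp only [singlePoint, mem_ofPred_eq, mem_iInter]
  constructor
  · rintro ⟨h1, h2⟩ j
    by_cases h : j = i
    · simp [h, h1]
    · simp [h, h2 j h]
  · intro h
    exact ⟨by simpa using h i, fun j hj ↦ by simpa [hj] using h j⟩

theorem measurableSet_singlePoint {Ω ι : Type*} [Countable ι] (X : ι → Ω → Set ℝ) (i : ι)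
    {S B : Set ℝ} (hB : MeasurableSet B) (hBS : B ⊆ S) :
    MeasurableSet[jointSigma X S] (singlePoint X i B) := by
  classical
  rw [singlePoint_eq_iInter]
  exact MeasurableSet.iInter fun j ↦
    measurable_pointCount_jointSigma X j hB hBS (measurableSet_singleton _)

/-- Process `i` contributes the one-point Poisson weight and the others the zero-point weight. The
exponential factors are common to all marks, so the dependence on `i` is the factor `c i` alone. -/
theorem measure_singlePoint {Ω ι : Type*} [Fintype ι] [MeasurableSpace Ω] {μ : Measure Ω}
    {X : ι → Ω → Set ℝ} {c : ι → ℝ} (hc : ∀ i, 0 ≤ c i) {lam : ℝ → ℝ}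
    (hX : ∀ i, IsPoissonPointProcess μ (X i) (fun t ↦ c i * lam t))
    (hX_indep : iIndep (fun i ↦ processSigma (X i) univ) μ) {B : Set ℝ} (hB : MeasurableSet B)
    (hfin : meanMeasure lam B ≠ ∞) (i : ι) :
    μ (singlePoint X i B) = ENNReal.ofReal (c i) * ENNReal.ofReal
      ((meanMeasure lam B).toReal * ∏ j, Real.exp (-(c j * (meanMeasure lam B).toReal))) := by
  classical
  have h := (iIndep_iff _ μ).1 hX_indep Finset.univ
    (f := fun j ↦ {ω | pointCount (X j) B ω = ((if j = i then 1 else 0 : ℕ) : ℕ∞)})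
    (fun j _ ↦ measurable_pointCount_processSigma (X j) hB (subset_univ _)
      (measurableSet_singleton _))
  simp only [Finset.mem_univ, iInter_true] at h
  rw [singlePoint_eq_iInter, h]
  have hj : ∀ j, μ {ω | pointCount (X j) B ω = ((if j = i then 1 else 0 : ℕ) : ℕ∞)} =
      ENNReal.ofReal ((if j = i then c i * (meanMeasure lam B).toReal else 1) *
        Real.exp (-(c j * (meanMeasure lam B).toReal))) := fun j ↦ by
    have e := meanMeasure_const_mul (hc j) lam B
    rw [(hX j).measure_pointCount_eq hB
      (by rw [e]; exact ENNReal.mul_ne_top ENNReal.ofReal_ne_top hfin), e, ENNReal.toReal_mul,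
      ENNReal.toReal_ofReal (hc j)]
    by_cases hji : j = i
    · simp [hji, mul_comm]
    · simp [hji]
  rw [Finset.prod_congr rfl fun j _ ↦ hj j, ← ENNReal.ofReal_prod_of_nonneg fun j _ ↦ by
      have := hc i
      split_ifs <;> positivity,
    Finset.prod_mul_distrib, Finset.prod_ite_eq', if_pos (Finset.mem_univ i),
    ← ENNReal.ofReal_mul (hc i), mul_assoc]

/-- The event that a cell of mesh `h` sees `n` points between `t` and its left end and holds a
single point, of mark `i`. -/
def meshMark {Ω ι : Type*} (X : ι → Ω → Set ℝ) (t h : ℝ) (n : ℕ) (i : ι) (k : ℕ) : Set Ω :=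
  {ω | ((⋃ j, X j ω) ∩ Ioc t (t + k * h)).encard = n} ∩ singlePoint X i (meshCell t h k)

theorem exists_of_mem_meshMark {Ω ι : Type*} {X : ι → Ω → Set ℝ} {t h : ℝ} (hh : 0 < h) {n : ℕ}
    {i : ι} {k : ℕ} {ω : Ω} (hω : ω ∈ meshMark X t h n i k) :
    ∃ x ∈ X i ω, x ∈ meshCell t h k ∧ IsNthPointAfter (⋃ j, X j ω) t n x := by
  obtain ⟨hn, h1, h0⟩ := hω
  obtain ⟨x, hx⟩ := encard_eq_one.1 h1
  have hxm : x ∈ X i ω ∩ meshCell t h k := hx ▸ mem_singleton x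
  have hkh : 0 ≤ k * h := by positivity
  refine ⟨x, hxm.1, hxm.2, mem_iUnion_of_mem i hxm.1, by linarith [hxm.2.1], ?_⟩
  rw [← inter_Ioc_eq_inter_Ioo hxm.2.1 ?_]
  · exact hn
  refine subset_empty_iff.1 ?_
  rintro z ⟨hz, hz1, hz2⟩
  have hzc : z ∈ meshCell t h k := ⟨hz1, hz2.le.trans hxm.2.2⟩
  obtain ⟨j, hj⟩ := mem_iUnion.1 hz
  by_cases hji : j = i
  · subst hji
    have : z = x := hx.subset ⟨hj, hzc⟩
    exact absurd hz2 (by rw [this]; exact lt_irrefl _)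
  · exact (encard_eq_zero.1 (h0 j hji)).subset ⟨hj, hzc⟩

theorem IsNthPointAfter.unique {S : Set ℝ} {t : ℝ} {n : ℕ} {x y : ℝ} (hx : IsNthPointAfter S t n x)
    (hy : IsNthPointAfter S t n y) : x = y := by
  wlog hxy : x < y generalizing x y
  · rcases lt_trichotomy x y with h | h | h
    exacts [(hxy h).elim, h, (this hy hx h).symm]
  have hfin : (S ∩ Ioo t x).Finite := finite_of_encard_eq_coe hx.2.2
  have hsub : insert x (S ∩ Ioo t x) ⊆ S ∩ Ioo t y :=
    insert_subset ⟨hx.1, hx.2.1, hxy⟩ fun z hz ↦ ⟨hz.1, hz.2.1, hz.2.2.trans hxy⟩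
  have h := encard_le_encard hsub
  rw [encard_insert_of_notMem (fun h ↦ lt_irrefl _ h.2.2), hx.2.2, hy.2.2] at h
  exact absurd h (by norm_cast; omega)

/-- The point number `n` is unique and lies in only one cell. -/
theorem pairwise_disjoint_meshMark {Ω ι : Type*} (X : ι → Ω → Set ℝ) (t : ℝ) {h : ℝ} (hh : 0 < h)
    (n : ℕ) (i : ι) : Pairwise (Function.onFun Disjoint (meshMark X t h n i)) := by
  intro k l hkl
  refine disjoint_left.2 fun ω hk hl ↦ ?_
  obtain ⟨x, -, hx, hxn⟩ := exists_of_mem_meshMark hh hk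
  obtain ⟨y, -, hy, hyn⟩ := exists_of_mem_meshMark hh hl
  obtain rfl := hxn.unique hyn
  exact disjoint_left.1 (pairwise_disjoint_meshCell t hh hkl) hx hy

/-- Fine meshes detect the mark of the `n`-th point when no two processes share a point. -/
theorem eventually_mem_iUnion_meshMark_iff {Ω ι : Type*} [Finite ι] {X : ι → Ω → Set ℝ} {t : ℝ}
    {n : ℕ} {i : ι} {ω : Ω} (hfin : ∀ j a b, (X j ω ∩ Icc a b).Finite)
    (hdisj : ∀ i j, i ≠ j → ∀ x, t < x → x ∈ X i ω → x ∉ X j ω) :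
    ∀ᶠ m : ℕ in atTop, ω ∈ ⋃ k, meshMark X t (1 / ((m : ℝ) + 1)) n i k ↔
      ω ∈ nthPointHasMark X t n i := by
  have hpos : ∀ m : ℕ, 0 < 1 / ((m : ℝ) + 1) := fun m ↦ by positivity
  by_cases hω : ω ∈ nthPointHasMark X t n i
  swap
  -- A mesh of any size gives no false detection; fineness matters only for the converse.
  · refine Eventually.of_forall fun m ↦ iff_of_false (fun H ↦ hω ?_) hω
    obtain ⟨k, hk⟩ := mem_iUnion.1 H
    obtain ⟨x, hx, -, hxn⟩ := exists_of_mem_meshMark (hpos m) hk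
    exact ⟨x, hx, hxn⟩
  obtain ⟨x, hxi, hxn⟩ := hω
  have hU := locallyFinite_iUnion hfin
  obtain ⟨l, -, hlx, hl⟩ := exists_Ioo_left_eq_empty hU (sub_one_lt x)
  obtain ⟨r, hxr, -, hr⟩ := exists_Ioo_right_eq_empty hU (lt_add_one x)
  -- A mesh below both gaps around `x` leaves `x` alone in its cell.
  have hε : 0 < min (x - l) (r - x) := lt_min (sub_pos.2 hlx) (sub_pos.2 hxr)
  filter_upwards [(tendsto_one_div_add_atTop_nhds_zero_nat (𝕜 := ℝ)).eventually_lt_const hε]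
    with m hm
  refine iff_of_true ?_ ⟨x, hxi, hxn⟩
  obtain ⟨k, hk⟩ := exists_mem_meshCell (hpos m) hxn.2.1
  have hm1 := hm.trans_le (min_le_left _ _)
  have hm2 := hm.trans_le (min_le_right _ _)
  set h := 1 / ((m : ℝ) + 1)
  have hk1 : t + k * h < x := hk.1
  have hk2 : x ≤ t + (k + 1) * h := hk.2
  have hcell : ∀ z ∈ (⋃ j, X j ω) ∩ meshCell t h k, z = x := by
    rintro z ⟨hz, hz1, hz2⟩
    rcases lt_trichotomy z x with hzx | hzx | hzx
    · exact (hl.subset ⟨hz, by linarith, hzx⟩).elim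
    · exact hzx
    · exact (hr.subset ⟨hz, hzx, by linarith⟩).elim
  refine mem_iUnion.2 ⟨k, ?_, encard_eq_one.2 ⟨x, ?_⟩, fun j hj ↦ encard_eq_zero.2 ?_⟩
  · refine (congrArg encard (inter_Ioc_eq_inter_Ioo hk1 (subset_empty_iff.1 ?_))).trans hxn.2.2
    rintro z ⟨hz, hz1, hz2⟩
    exact hl.subset ⟨hz, by linarith, hz2⟩
  · ext z
    refine ⟨fun hz ↦ hcell z ⟨mem_iUnion_of_mem i hz.1, hz.2⟩, ?_⟩
    rintro rfl
    exact ⟨hxi, hk⟩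
  · refine subset_empty_iff.1 fun z hz ↦ ?_
    obtain rfl := hcell z ⟨mem_iUnion_of_mem j hz.1, hz.2⟩
    exact hdisj i j hj.symm z hxn.2.1 hxi hz.1

theorem nthPointHasMark_inter_eq_empty {Ω ι : Type*} {X : ι → Ω → Set ℝ} {t : ℝ} {ω : Ω}
    (hdisj : ∀ i j, i ≠ j → ∀ x, t < x → x ∈ X i ω → x ∉ X j ω) (n : ℕ) {i j : ι}
    (hi : ω ∈ nthPointHasMark X t n i) (hj : ω ∈ nthPointHasMark X t n j) : i = j := by
  by_contra hij
  obtain ⟨x, hx, hxn⟩ := hi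
  obtain ⟨y, hy, hyn⟩ := hj
  obtain rfl := hxn.unique hyn
  exact hdisj i j hij x hxn.2.1 hx hy

theorem jointSigma_le {Ω ι : Type*} [mΩ : MeasurableSpace Ω] {μ : Measure Ω} {X : ι → Ω → Set ℝ}
    {lam : ι → ℝ → ℝ} (hX : ∀ i, IsPoissonPointProcess μ (X i) (lam i)) (S : Set ℝ) :
    jointSigma X S ≤ mΩ :=
  iSup_le fun i ↦ (hX i).processSigma_le S

theorem meanMeasure_const_mul_Ioc_ne_top {ι : Type*} {c : ι → ℝ} {lam : ℝ → ℝ} (hc : ∀ i, 0 ≤ c i)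
    (hlam : LocallyIntegrable lam volume) (i : ι) (a b : ℝ) :
    meanMeasure (fun t ↦ c i * lam t) (Ioc a b) ≠ ∞ := by
  rw [meanMeasure_const_mul (hc i)]
  exact ENNReal.mul_ne_top ENNReal.ofReal_ne_top (meanMeasure_Ioc_ne_top hlam a b)

/-! ### The mark of the next point given the history -/

section NextMark

variable {Ω ι : Type*} [Fintype ι] [mΩ : MeasurableSpace Ω] {μ : Measure Ω} [IsProbabilityMeasure μ]
  {X : ι → Ω → Set ℝ} {c : ι → ℝ} {lam : ℝ → ℝ}

/-- The probability that a fine mesh detects mark `i` is proportional to the rate of process `i`. -/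
theorem exists_measure_iUnion_meshMark_eq (hc : ∀ i, 0 ≤ c i)
    (hlam : LocallyIntegrable lam volume)
    (hX : ∀ i, IsPoissonPointProcess μ (X i) (fun t ↦ c i * lam t))
    (hX_indep : iIndep (fun i ↦ processSigma (X i) univ) μ) (t : ℝ) {h : ℝ} (hh : 0 < h) (n : ℕ)
    {A : Set Ω} (hA : MeasurableSet[history X t n] A) :
    ∃ K : ℝ≥0∞, ∀ i, μ (A ∩ ⋃ k, meshMark X t h n i k) = ENNReal.ofReal (c i) * K := by
  have hlf : ∀ i ω a b, (X i ω ∩ Icc a b).Finite := fun i ↦ (hX i).locallyFinite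
  let A' : ℕ → Set Ω := fun k ↦ A ∩ {ω | ((⋃ j, X j ω) ∩ Ioc t (t + k * h)).encard = n}
  have hA' : ∀ k : ℕ, MeasurableSet[jointSigma X (Iic (t + k * h))] (A' k) := fun k ↦
    measurableSet_history_inter hlf (by linarith [show 0 ≤ k * h by positivity]) hA
  have hD : ∀ i (k : ℕ), MeasurableSet[jointSigma X (Ioi (t + k * h))]
      (singlePoint X i (meshCell t h k)) := fun i k ↦
    measurableSet_singlePoint X i measurableSet_Ioc Ioc_subset_Ioi_self
  have hM : ∀ k, meanMeasure lam (meshCell t h k) ≠ ∞ := fun k ↦ meanMeasure_Ioc_ne_top hlam _ _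
  -- `K` sums, over cells, the probability of the past event times the part of the single-point
  -- probability that does not depend on the mark.
  refine ⟨∑' k, μ (A' k) * ENNReal.ofReal ((meanMeasure lam (meshCell t h k)).toReal *
    ∏ j, Real.exp (-(c j * (meanMeasure lam (meshCell t h k)).toReal))), fun i ↦ ?_⟩
  have e : A ∩ ⋃ k, meshMark X t h n i k = ⋃ k, A' k ∩ singlePoint X i (meshCell t h k) := by
    simp only [inter_iUnion, meshMark, A', inter_assoc]
  rw [e, measure_iUnion, ← ENNReal.tsum_mul_left]
  · refine tsum_congr fun k ↦ ?_
    rw [(Indep_iff _ _ μ).1 (indep_jointSigma hX hX_indep measurableSet_Iic measurableSet_Ioi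
      (disjoint_left.2 fun x hx hx' ↦ not_lt.2 (mem_Iic.1 hx) (mem_Ioi.1 hx'))) _ _ (hA' k) (hD i k),
      measure_singlePoint hc hX hX_indep (measurableSet_meshCell t h k) (hM k) i]
    ring
  · intro k l hkl
    refine (pairwise_disjoint_meshMark X t hh n i hkl).mono ?_ ?_ <;>
      exact fun ω hω ↦ ⟨hω.1.2, hω.2⟩
  · exact fun k ↦ (jointSigma_le hX _ _ (hA' k)).inter (jointSigma_le hX _ _ (hD i k))

/-- Off the null set where processes share a point, the indicators are eventually equal to their
limit. -/
theorem tendsto_measure_iUnion_meshMark (hc : ∀ i, 0 ≤ c i)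
    (hlam : LocallyIntegrable lam volume)
    (hX : ∀ i, IsPoissonPointProcess μ (X i) (fun t ↦ c i * lam t))
    (hX_indep : iIndep (fun i ↦ processSigma (X i) univ) μ) (t : ℝ) (n : ℕ)
    {A : Set Ω} (hA : MeasurableSet[history X t n] A) (i : ι) :
    Tendsto (fun m : ℕ ↦ μ (A ∩ ⋃ k, meshMark X t (1 / ((m : ℝ) + 1)) n i k)) atTop
      (𝓝 (μ (A ∩ nthPointHasMark X t n i))) := by
  have hlf : ∀ i ω a b, (X i ω ∩ Icc a b).Finite := fun i ↦ (hX i).locallyFinite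
  have hAm : MeasurableSet A := jointSigma_le hX _ _ (history_le hlf t n A hA)
  refine tendsto_measure_of_ae_tendsto_indicator_of_isFiniteMeasure _
    (hAm.inter (jointSigma_le hX _ _ (measurableSet_nthPointHasMark hlf t n i)))
    (fun m ↦ hAm.inter (MeasurableSet.iUnion fun k ↦ .inter
      (jointSigma_le hX univ _ (measurableSet_encard_union_eq hlf n _ _ (subset_univ _)))
      (jointSigma_le hX univ _
        (measurableSet_singlePoint X i measurableSet_Ioc (subset_univ _))))) ?_
  filter_upwards [ae_disjoint_Ioi hX hX_indep (meanMeasure_const_mul_Ioc_ne_top hc hlam) t]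
    with ω hω
  filter_upwards [eventually_mem_iUnion_meshMark_iff (n := n) (i := i) (fun j ↦ hlf j ω) hω]
    with m hm
  rw [mem_inter_iff, mem_inter_iff, hm]

/-- Marks exclude one another only almost surely, hence the additivity over null-overlapping sets.
-/
theorem measure_inter_nthPointExists (hc : ∀ i, 0 ≤ c i)
    (hlam : LocallyIntegrable lam volume)
    (hX : ∀ i, IsPoissonPointProcess μ (X i) (fun t ↦ c i * lam t))
    (hX_indep : iIndep (fun i ↦ processSigma (X i) univ) μ) (t : ℝ) (n : ℕ)
    {A : Set Ω} (hA : MeasurableSet[history X t n] A) :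
    μ (A ∩ nthPointExists X t n) = ∑ i, μ (A ∩ nthPointHasMark X t n i) := by
  have hlf : ∀ i ω a b, (X i ω ∩ Icc a b).Finite := fun i ↦ (hX i).locallyFinite
  have hAm : MeasurableSet A := jointSigma_le hX _ _ (history_le hlf t n A hA)
  rw [nthPointExists_eq_iUnion, inter_iUnion, measure_iUnion₀, tsum_fintype]
  · intro i j hij
    refine measure_mono_null (t := {ω | ¬∀ i j, i ≠ j → ∀ x, t < x → x ∈ X i ω → x ∉ X j ω}) ?_
      (ae_disjoint_Ioi hX hX_indep (meanMeasure_const_mul_Ioc_ne_top hc hlam) t)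
    exact fun ω hω hdisj ↦ hij (nthPointHasMark_inter_eq_empty hdisj n hω.1.2 hω.2.2)
  · exact fun i ↦ (hAm.inter
      (jointSigma_le hX _ _ (measurableSet_nthPointHasMark hlf t n i))).nullMeasurableSet

/-- The mark of the next point is drawn in proportion to the rates, independently of the history. -/
theorem measure_inter_nthPointHasMark (hc : ∀ i, 0 ≤ c i) (hc_pos : 0 < ∑ i, c i)
    (hlam : LocallyIntegrable lam volume)
    (hX : ∀ i, IsPoissonPointProcess μ (X i) (fun t ↦ c i * lam t))
    (hX_indep : iIndep (fun i ↦ processSigma (X i) univ) μ) (t : ℝ) (n : ℕ) (i : ι)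
    {A : Set Ω} (hA : MeasurableSet[history X t n] A) :
    μ (A ∩ nthPointHasMark X t n i) =
      ENNReal.ofReal (c i / ∑ j, c j) * μ (A ∩ nthPointExists X t n) := by
  -- The cross-multiplied form eliminates `K`, which depends on the mesh, and stays valid when some
  -- rates vanish.
  have hcross : ∀ j, ENNReal.ofReal (c j) * μ (A ∩ nthPointHasMark X t n i) =
      ENNReal.ofReal (c i) * μ (A ∩ nthPointHasMark X t n j) := fun j ↦ by
    refine tendsto_nhds_unique
      (ENNReal.Tendsto.const_mul (tendsto_measure_iUnion_meshMark hc hlam hX hX_indep t n hA i)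
        (Or.inr ENNReal.ofReal_ne_top)) ?_
    refine (ENNReal.Tendsto.const_mul (tendsto_measure_iUnion_meshMark hc hlam hX hX_indep t n hA j)
        (Or.inr ENNReal.ofReal_ne_top)).congr fun m ↦ ?_
    obtain ⟨K, hK⟩ := exists_measure_iUnion_meshMark_eq hc hlam hX hX_indep t
      (h := 1 / ((m : ℝ) + 1)) (by positivity) n hA
    rw [hK, hK]
    ring
  have hsum : ENNReal.ofReal (∑ j, c j) * μ (A ∩ nthPointHasMark X t n i) =
      ENNReal.ofReal (c i) * μ (A ∩ nthPointExists X t n) := by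
    rw [measure_inter_nthPointExists hc hlam hX hX_indep t n hA, Finset.mul_sum,
      ENNReal.ofReal_sum_of_nonneg fun j _ ↦ hc j, Finset.sum_mul]
    exact Finset.sum_congr rfl fun j _ ↦ hcross j
  rw [ENNReal.ofReal_div_of_pos hc_pos, div_eq_mul_inv, mul_right_comm, ← hsum, mul_right_comm,
    ENNReal.mul_inv_cancel (by simpa using hc_pos) ENNReal.ofReal_ne_top, one_mul]

end NextMark

/-! ### Infinitely many points and the sequence of marks -/

/-- An infinite, locally finite set of points after `t` can be enumerated. -/
theorem exists_isNthPointAfter {U : Set ℝ} (hU : ∀ a b, (U ∩ Icc a b).Finite) {t : ℝ}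
    (hinf : (U ∩ Ioi t).Infinite) (n : ℕ) : ∃ x, IsNthPointAfter U t n x := by
  have hnext : ∀ x, t ≤ x → ∃ y ∈ U, x < y ∧ U ∩ Ioo x y = ∅ := by
    intro x htx
    obtain ⟨z, hz⟩ : (U ∩ Ioi x).Nonempty := by
      rw [nonempty_iff_ne_empty]
      intro h
      refine hinf ((finite_inter_Ioc hU t x).subset ?_)
      exact fun z hz ↦ ⟨hz.1, hz.2, not_lt.1 fun hxz ↦ h.subset ⟨hz.1, hxz⟩⟩
    obtain ⟨y, hy, hmin⟩ := (finite_inter_Ioc hU x z).exists_minimal ⟨z, hz.1, hz.2, le_rfl⟩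
    refine ⟨y, hy.1, hy.2.1, subset_empty_iff.1 fun w hw ↦ ?_⟩
    exact absurd (hmin ⟨hw.1, hw.2.1, hw.2.2.le.trans hy.2.2⟩ hw.2.2.le) (not_le.2 hw.2.2)
  induction n with
  | zero =>
    obtain ⟨y, hy, hty, he⟩ := hnext t le_rfl
    exact ⟨y, hy, hty, by simp [he]⟩
  | succ n ih =>
    obtain ⟨x, hxU, htx, hx⟩ := ih
    obtain ⟨y, hy, hxy, he⟩ := hnext x htx.le
    refine ⟨y, hy, htx.trans hxy, ?_⟩
    have : U ∩ Ioo t y = insert x (U ∩ Ioo t x) := by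
      ext z
      constructor
      · rintro ⟨hz, hz1, hz2⟩
        rcases lt_trichotomy z x with h | h | h
        · exact Or.inr ⟨hz, hz1, h⟩
        · exact Or.inl h
        · exact (he.subset ⟨hz, h, hz2⟩).elim
      · rintro (rfl | ⟨hz, hz1, hz2⟩)
        · exact ⟨hxU, htx, hxy⟩
        · exact ⟨hz, hz1, hz2.trans hxy⟩
    rw [this, encard_insert_of_notMem (fun h ↦ lt_irrefl _ h.2.2), hx]
    norm_cast

theorem measurable_markVector {Ω ι : Type*} {X : ι → Ω → Set ℝ} {m : MeasurableSpace Ω} {t : ℝ}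
    {n : ℕ} (h : ∀ i, MeasurableSet (nthPointHasMark X t n i)) : Measurable (markVector X t n) :=
  measurable_pi_iff.2 fun i ↦ measurable_const.indicator (h i)

theorem markVector_eq_single {Ω ι : Type*} [DecidableEq ι] {X : ι → Ω → Set ℝ} {t : ℝ} {ω : Ω}
    (hdisj : ∀ i j, i ≠ j → ∀ x, t < x → x ∈ X i ω → x ∉ X j ω) {n : ℕ} {i : ι}
    (hi : ω ∈ nthPointHasMark X t n i) : markVector X t n ω = Pi.single i 1 := by
  ext j
  by_cases hj : j = i
  · subst hj
    simp [markVector, hi]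
  · have : ω ∉ nthPointHasMark X t n j := fun h ↦
      hj (nthPointHasMark_inter_eq_empty hdisj n h hi)
    simp [markVector, this, hj]

theorem multinomialOne_apply {d : ℕ} (θ : Fin d → ℝ) {S : Set (Fin d → ℕ)} (hS : MeasurableSet S)
    [DecidablePred fun i : Fin d ↦ (Pi.single i 1 : Fin d → ℕ) ∈ S] :
    multinomialOne θ S =
      ∑ i with (Pi.single i 1 : Fin d → ℕ) ∈ S, ENNReal.ofReal (θ i) := by
  simp only [multinomialOne, Measure.finsetSum_apply, Measure.smul_apply, smul_eq_mul,
    Measure.dirac_apply' _ hS, Finset.sum_filter]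
  refine Finset.sum_congr rfl fun i _ ↦ ?_
  by_cases h : (Pi.single i 1 : Fin d → ℕ) ∈ S <;> simp [h]

/-- Process `i` alone suffices: its mean on `Ioi t` is infinite, and `extPoisson ∞` is the point
mass at `⊤`. -/
theorem ae_nthPointExists {Ω ι : Type*} [Finite ι] [MeasurableSpace Ω] {μ : Measure Ω}
    {X : ι → Ω → Set ℝ} {c : ι → ℝ} {lam : ℝ → ℝ} {i : ι} (hi : 0 < c i)
    (hX : ∀ i, IsPoissonPointProcess μ (X i) (fun t ↦ c i * lam t)) {t : ℝ}
    (htop : meanMeasure lam (Ioi t) = ∞) : ∀ᵐ ω ∂μ, ∀ n, ω ∈ nthPointExists X t n := by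
  have hlaw := (hX i).hasLaw_count (Ioi t) measurableSet_Ioi
  rw [meanMeasure_const_mul hi.le, htop, ENNReal.mul_top (by simpa using hi), extPoisson,
    if_pos rfl] at hlaw
  have hae : ∀ᵐ ω ∂μ, pointCount (X i) (Ioi t) ω = ⊤ :=
    (hlaw.ae_iff (p := fun x ↦ x = ⊤) .of_discrete).2 (by simp [ae_dirac_eq])
  filter_upwards [hae] with ω hω n
  refine exists_isNthPointAfter (locallyFinite_iUnion fun j ↦ (hX j).locallyFinite ω) ?_ n
  exact (encard_eq_top_iff.1 hω).mono (by gcongr; exact subset_iUnion (fun j ↦ X j ω) i)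

section MarkSequence

variable {Ω : Type*} [mΩ : MeasurableSpace Ω] {μ : Measure Ω} [IsProbabilityMeasure μ] {d : ℕ}
  {X : Fin d → Ω → Set ℝ} {c : Fin d → ℝ} {lam : ℝ → ℝ}

/-- The mark vector is almost surely a unit vector, so the event splits into the mark events with
`Pi.single i 1 ∈ S`, and `measure_inter_nthPointHasMark` applies to each. With `A = univ` this gives
the law, with general `A` the independence from the past. -/
theorem measure_inter_markVector_preimage (hc : ∀ i, 0 ≤ c i) (hc_pos : 0 < ∑ i, c i)
    (hlam : LocallyIntegrable lam volume)
    (hX : ∀ i, IsPoissonPointProcess μ (X i) (fun t ↦ c i * lam t))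
    (hX_indep : iIndep (fun i ↦ processSigma (X i) univ) μ) {t : ℝ}
    (hex : ∀ᵐ ω ∂μ, ∀ n, ω ∈ nthPointExists X t n) (n : ℕ)
    {A : Set Ω} (hA : MeasurableSet[history X t n] A) {S : Set (Fin d → ℕ)} (hS : MeasurableSet S) :
    μ (A ∩ markVector X t n ⁻¹' S) = μ A * multinomialOne (fun i ↦ c i / ∑ j, c j) S := by
  classical
  have hlf : ∀ i ω a b, (X i ω ∩ Icc a b).Finite := fun i ↦ (hX i).locallyFinite
  have hAm : MeasurableSet A := jointSigma_le hX _ _ (history_le hlf t n A hA)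
  have hdisj := ae_disjoint_Ioi hX hX_indep (meanMeasure_const_mul_Ioc_ne_top hc hlam) t
  have hexA : μ (A ∩ nthPointExists X t n) = μ A := by
    refine measure_congr ?_
    filter_upwards [hex] with ω hω
    exact propext ⟨fun h ↦ h.1, fun h ↦ ⟨h, hω n⟩⟩
  have e : (A ∩ markVector X t n ⁻¹' S : Set Ω) =ᵐ[μ]
      ⋃ i ∈ Finset.univ.filter (fun i : Fin d ↦ (Pi.single i 1 : Fin d → ℕ) ∈ S),
        A ∩ nthPointHasMark X t n i := by
    filter_upwards [hex, hdisj] with ω hω hωd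
    have hωn := hω n
    rw [nthPointExists_eq_iUnion] at hωn
    obtain ⟨i, hi⟩ := mem_iUnion.1 hωn
    refine propext (Iff.trans (b := ω ∈ A ∧ (Pi.single i 1 : Fin d → ℕ) ∈ S) ?_ ?_)
    · rw [← markVector_eq_single hωd hi]
      rfl
    · change _ ↔ ω ∈ ⋃ i ∈ _, _
      simp only [mem_iUnion, Finset.mem_filter, Finset.mem_univ, true_and, exists_prop]
      constructor
      · exact fun h ↦ ⟨i, h.2, h.1, hi⟩
      · rintro ⟨j, hj, hjA, hjm⟩
        obtain rfl := nthPointHasMark_inter_eq_empty hωd n hi hjm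
        exact ⟨hjA, hj⟩
  rw [measure_congr e, measure_biUnion_finset₀, multinomialOne_apply _ hS, Finset.mul_sum]
  · refine Finset.sum_congr rfl fun i _ ↦ ?_
    rw [measure_inter_nthPointHasMark hc hc_pos hlam hX hX_indep t n i hA, hexA, mul_comm]
  · intro i _ j _ hij
    refine measure_mono_null ?_ hdisj
    exact fun ω hω hdisj ↦ hij (nthPointHasMark_inter_eq_empty hdisj n hω.1.2 hω.2.2)
  · exact fun i _ ↦ (hAm.inter
      (jointSigma_le hX _ _ (measurableSet_nthPointHasMark hlf t n i))).nullMeasurableSet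

theorem hasLaw_markVector (hc : ∀ i, 0 ≤ c i) (hc_pos : 0 < ∑ i, c i)
    (hlam : LocallyIntegrable lam volume)
    (hX : ∀ i, IsPoissonPointProcess μ (X i) (fun t ↦ c i * lam t))
    (hX_indep : iIndep (fun i ↦ processSigma (X i) univ) μ) {t : ℝ}
    (hex : ∀ᵐ ω ∂μ, ∀ n, ω ∈ nthPointExists X t n) (n : ℕ) :
    HasLaw (markVector X t n) (multinomialOne fun i ↦ c i / ∑ j, c j) μ := by
  have hm : Measurable (markVector X t n) := measurable_markVector fun i ↦
    jointSigma_le hX _ _ (measurableSet_nthPointHasMark (fun i ↦ (hX i).locallyFinite) t n i)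
  refine ⟨hm.aemeasurable, Measure.ext fun S hS ↦ ?_⟩
  have h := measure_inter_markVector_preimage hc hc_pos hlam hX hX_indep hex n
    (A := univ) .univ hS
  rwa [univ_inter, measure_univ, one_mul, ← Measure.map_apply hm hS] at h

theorem iIndepFun_markVector (hc : ∀ i, 0 ≤ c i) (hc_pos : 0 < ∑ i, c i)
    (hlam : LocallyIntegrable lam volume)
    (hX : ∀ i, IsPoissonPointProcess μ (X i) (fun t ↦ c i * lam t))
    (hX_indep : iIndep (fun i ↦ processSigma (X i) univ) μ) {t : ℝ}
    (hex : ∀ᵐ ω ∂μ, ∀ n, ω ∈ nthPointExists X t n) :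
    iIndepFun (fun n ↦ markVector X t n) μ := by
  rw [iIndepFun_iff_measure_inter_preimage_eq_mul]
  intro s f
  induction s using Finset.induction_on_max with
  | empty => simp
  | insert n s hn ih =>
    intro hf
    -- Since `n` exceeds every index in `s`, the event on the earlier marks lies in the history just
    -- before point number `n`, as the induction on the maximum requires.
    have hs : MeasurableSet[history X t n] (⋂ k ∈ s, markVector X t k ⁻¹' f k) :=
      s.measurableSet_biInter fun k hk ↦
        measurable_markVector (m := history X t n) (fun i ↦
          measurableSet_history_nthPointHasMark X t (hn k hk) i) (hf k (Finset.mem_insert_of_mem hk))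
    have hfn := hf n (Finset.mem_insert_self n s)
    rw [Finset.set_biInter_insert, Finset.prod_insert fun h ↦ lt_irrefl n (hn n h), inter_comm,
      measure_inter_markVector_preimage hc hc_pos hlam hX hX_indep hex n hs hfn,
      ih fun k hk ↦ hf k (Finset.mem_insert_of_mem hk), mul_comm]
    exact congrArg (· * _) ((hasLaw_markVector hc hc_pos hlam hX hX_indep hex n).measure_eq
      (p := fun v ↦ v ∈ f n) hfn).symm

end MarkSequence

theorem mainTheorem5 {Ω : Type*} [MeasurableSpace Ω] (μ : Measure Ω) [IsProbabilityMeasure μ]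
    (d : ℕ) (ρ δ : Fin d → ℝ) (hρ : ∀ i, 0 ≤ ρ i) (hρ_pos : ∃ i, 0 < ρ i)
    (lam : ℝ → ℝ) (hlam : ∀ t, 0 ≤ lam t) (hlam_int : LocallyIntegrable lam volume)
    (X : Fin d → Ω → Set ℝ)
    (hX : ∀ i, IsPoissonPointProcess μ (X i) (fun t => ρ i * Real.exp (δ i) * lam t))
    (hX_indep : iIndep (fun i => processSigma (X i) univ) μ) (t : ℝ) :
    (∀ (n : ℕ) (i : Fin d) (A : Set Ω), MeasurableSet[history X t n] A →
      μ (A ∩ nthPointHasMark X t n i)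
        = ENNReal.ofReal (softmaxWeight ρ δ i) * μ (A ∩ nthPointExists X t n)) ∧
    (meanMeasure lam (Ioi t) = ∞ →
      (∀ᵐ ω ∂μ, ∀ n, ω ∈ nthPointExists X t n) ∧
      (∀ i, μ (nthPointHasMark X t 0 i) = ENNReal.ofReal (softmaxWeight ρ δ i)) ∧
      iIndepFun (fun n => markVector X t n) μ ∧
      ∀ n, HasLaw (markVector X t n) (multinomialOne (softmaxWeight ρ δ)) μ) := by
  have hc : ∀ i, 0 ≤ ρ i * Real.exp (δ i) := fun i ↦ mul_nonneg (hρ i) (Real.exp_nonneg _)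
  obtain ⟨i₀, hi₀⟩ := hρ_pos
  have hi₀' : 0 < ρ i₀ * Real.exp (δ i₀) := mul_pos hi₀ (Real.exp_pos _)
  have hc_pos : 0 < ∑ i, ρ i * Real.exp (δ i) :=
    Finset.sum_pos' (fun i _ ↦ hc i) ⟨i₀, Finset.mem_univ _, hi₀'⟩
  have hmark : ∀ (n : ℕ) (i : Fin d) (A : Set Ω), MeasurableSet[history X t n] A →
      μ (A ∩ nthPointHasMark X t n i)
        = ENNReal.ofReal (softmaxWeight ρ δ i) * μ (A ∩ nthPointExists X t n) :=
    fun n i A hA ↦ measure_inter_nthPointHasMark (c := fun i ↦ ρ i * Real.exp (δ i)) hc hc_pos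
      hlam_int hX hX_indep t n i hA
  refine ⟨hmark, fun htop ↦ ?_⟩
  have hex : ∀ᵐ ω ∂μ, ∀ n, ω ∈ nthPointExists X t n :=
    ae_nthPointExists (c := fun i ↦ ρ i * Real.exp (δ i)) hi₀' hX htop
  refine ⟨hex, fun i ↦ ?_, iIndepFun_markVector (c := fun i ↦ ρ i * Real.exp (δ i)) hc hc_pos
    hlam_int hX hX_indep hex, hasLaw_markVector (c := fun i ↦ ρ i * Real.exp (δ i)) hc hc_pos
    hlam_int hX hX_indep hex⟩
  have h1 : μ (nthPointExists X t 0) = 1 := by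
    rw [← measure_univ (μ := μ)]
    exact measure_congr (Filter.eventuallyEq_univ.2 (hex.mono fun ω h ↦ h 0))
  have h := hmark 0 i univ .univ
  rwa [univ_inter, univ_inter, h1, mul_one] at h
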